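/- Let $n\ge 0$ and let $H_n$ be the Hecke algebra over the field $\mathbb{C}(q)$, i.e. the associative unital algebra with generators $T_1,\dots,T_{n-1}$ and relations $$(T_i-q)(T_i+q^{-1})=0,\qquad T_iT_{i+1}T_i=T_{i+1}T_iT_{i+1},\qquad T_iT_j=T_jT_i\ \ (|i-j|>1).$$ For $1\le k\le n-1$ and $a,b\in\mathbb{C}(q)$ with $a\ne 0$, $a\neq b$ put $$F_k(a,b)=T_k+\frac{q-q^{-1}}{a^{-1}b-1}\in H_n .$$ Let $\Lambda$ be a standard tableau with $n$ boxes (a filling of the Young diagram $\lambda$ of a partition of $n$ by the numbers $1,\dots,n$, each used once, increasing along rows and down columns), and let $c_a(\Lambda)=(\text{column})-(\text{row})$ be the content of the box of $\Lambda$ containing $a$. Consider the $H_n$-valued rational function of $z_1,\dots,z_n$ $$F_\Lambda(z_1,\dots,z_n)=\prod_{1\le i<j\le n}^{\rightarrow}F_{j-i}\bigl(q^{2c_i(\Lambda)}z_i,\;q^{2c_j(\Lambda)}z_j\bigr),$$ where the factors are multiplied from left to right in the order in which $(i,j)$ precedes $(i',j')$ if $j<j'$, or if $j=j'$ and $i<i'$.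 Let $\mathcal{H}_\Lambda\subset\mathbb{C}(q)^n$ be the subspace of all tuples $(z_1,\dots,z_n)$ with $z_a=z_b$ whenever $a$ and $b$ lie in the same principal hook of $\Lambda$; here the $k$-th principal hook consists of the boxes $(k,j)$ of $\lambda$ with $j\ge k$ and the boxes $(i,k)$ of $\lambda$ with $i\ge k$. **Proposition.** The restriction of $F_\Lambda(z_1,\dots,z_n)$ to $\mathcal{H}_\Lambda$ is a well-defined rational function on $\mathcal{H}_\Lambda$ (there are points of $\mathcal{H}_\Lambda$ at which every factor is defined), and it is regular at $z_1=\cdots=z_n\neq 0$. That is, for every $y\in\mathbb{C}(q)\setminus\{0\}$ there are an $H_n$-valued polynomial $P$ and a $\mathbb{C}(q)$-valued polynomial $g$ in $z_1,\dots,z_n$ with $g(y,\dots,y)\ne 0$ and $g\cdot F_\Lambda=P$ at all points of $\mathcal{H}_\Lambda$ at which every factor of $F_\Lambda$ is defined. -/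

import Mathlib

namespace HookFusion

/-- The ground field `ℂ(q)` of rational functions in one variable over `ℂ`. -/
abbrev Cq : Type := RatFunc ℂ

/-- The variable `q` of `ℂ(q)`. -/
noncomputable def q : Cq := RatFunc.X

/-! ### The Hecke algebra -/

/-- Indices of the generators `T_1, …, T_{n-1}`: the integers `k` with `1 ≤ k ≤ n - 1`. -/
abbrev GenIndex (n : ℕ) : Type := {k : ℕ // 1 ≤ k ∧ k < n}

/-- The defining relations of the Hecke algebra, imposed on the free algebra on `T_1, …, T_{n-1}`:
the quadratic relation `(T_i - q)(T_i + q⁻¹) = 0`, the braid relation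
`T_i T_{i+1} T_i = T_{i+1} T_i T_{i+1}`, and the commutation of `T_i`, `T_j` for `|i - j| > 1`. -/
inductive HeckeRel (n : ℕ) :
    FreeAlgebra Cq (GenIndex n) → FreeAlgebra Cq (GenIndex n) → Prop
  | quadratic (i : GenIndex n) :
      HeckeRel n
        ((FreeAlgebra.ι Cq i - algebraMap Cq (FreeAlgebra Cq (GenIndex n)) q) *
          (FreeAlgebra.ι Cq i + algebraMap Cq (FreeAlgebra Cq (GenIndex n)) q⁻¹))
        0
  | braid (i j : GenIndex n) (h : (j : ℕ) = (i : ℕ) + 1) :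
      HeckeRel n
        (FreeAlgebra.ι Cq i * FreeAlgebra.ι Cq j * FreeAlgebra.ι Cq i)
        (FreeAlgebra.ι Cq j * FreeAlgebra.ι Cq i * FreeAlgebra.ι Cq j)
  | comm (i j : GenIndex n) (h : (i : ℕ) + 1 < (j : ℕ)) :
      HeckeRel n
        (FreeAlgebra.ι Cq i * FreeAlgebra.ι Cq j)
        (FreeAlgebra.ι Cq j * FreeAlgebra.ι Cq i)

/-- The Hecke algebra `H_n` over `ℂ(q)`, by generators and relations. -/
abbrev Hecke (n : ℕ) : Type := RingQuot (HeckeRel n)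

/-- The generator `T_k` of `H_n`. -/
noncomputable def T {n : ℕ} (k : GenIndex n) : Hecke n :=
  RingQuot.mkAlgHom Cq (HeckeRel n) (FreeAlgebra.ι Cq k)

/-! ### Standard tableaux, contents, principal hooks -/

/-- A standard tableau of shape `μ` with `n` boxes: a filling of the boxes of `μ` by the numbers
`1, …, n`, each used exactly once, increasing along rows and down columns. It is given by the
bijection sending a number to the box containing it; the element `a : Fin n` stands for the number
`a + 1`. The box `(r, c) : ℕ × ℕ` lies in row `r` and column `c`, counted from `0`. -/
structure StandardTableau (n : ℕ) (μ : YoungDiagram) where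
  /-- The box containing a given number. -/
  box : Fin n ≃ {x : ℕ × ℕ // x ∈ μ.cells}
  /-- Entries increase from left to right along each row. -/
  row_lt : ∀ a b : Fin n, (box a).1.1 = (box b).1.1 → (box a).1.2 < (box b).1.2 → a < b
  /-- Entries increase from top to bottom down each column. -/
  col_lt : ∀ a b : Fin n, (box a).1.2 = (box b).1.2 → (box a).1.1 < (box b).1.1 → a < b

/-- The content (column minus row) of the box of `Λ` containing a given number. -/
def StandardTableau.content {n : ℕ} {μ : YoungDiagram} (Λ : StandardTableau n μ) (a : Fin n) : ℤ :=
  ((Λ.box a).1.2 : ℤ) - ((Λ.box a).1.1 : ℤ)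

/-- The `(i, j)`-hook of `μ`: the boxes of `μ` that are in row `i` and weakly to the right of
column `j`, or in column `j` and weakly below row `i`. -/
def hook (μ : YoungDiagram) (i j : ℕ) : Set (ℕ × ℕ) :=
  {x | x ∈ μ ∧ ((x.1 = i ∧ j ≤ x.2) ∨ (x.2 = j ∧ i ≤ x.1))}

/-- The numbers `a` and `b` appear in the same principal hook of `Λ`, i.e. in the same `(k, k)`-hook
for some `k`. -/
def StandardTableau.SameHook {n : ℕ} {μ : YoungDiagram} (Λ : StandardTableau n μ)
    (a b : Fin n) : Prop :=
  ∃ k : ℕ, (Λ.box a).1 ∈ hook μ k k ∧ (Λ.box b).1 ∈ hook μ k k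

/-- The subspace of tuples `(z_1, …, z_n)` with `z_a = z_b` whenever `a` and `b` appear in the same
principal hook of `Λ`. -/
def StandardTableau.hookSubspace {n : ℕ} {μ : YoungDiagram} (Λ : StandardTableau n μ) :
    Submodule Cq (Fin n → Cq) where
  carrier := {z | ∀ a b : Fin n, Λ.SameHook a b → z a = z b}
  add_mem' := by
    intro z w hz hw a b h
    simp only [Pi.add_apply, hz a b h, hw a b h]
  zero_mem' := by
    intro a b _
    rfl
  smul_mem' := by
    intro c z hz a b h
    simp only [Pi.smul_apply, hz a b h]

/-! ### The functions `F_k(a, b)` and `F_Λ(z_1, …, z_n)` -/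

/-- `F_k(a, b) = T_k + (q - q⁻¹) / (a⁻¹ b - 1)`, meaningful for `a ≠ 0` and `a ≠ b`. -/
noncomputable def F {n : ℕ} (k : GenIndex n) (a b : Cq) : Hecke n :=
  T k + algebraMap Cq (Hecke n) ((q - q⁻¹) / (a⁻¹ * b - 1))

/-- The argument `q ^ (2 c_a(Λ)) z_a` belonging to the number `a`. -/
noncomputable def StandardTableau.arg {n : ℕ} {μ : YoungDiagram} (Λ : StandardTableau n μ)
    (z : Fin n → Cq) (a : Fin n) : Cq :=
  q ^ (2 * Λ.content a) * z a

/-- The index `j - i` of a generator, for `1 ≤ i < j ≤ n`. -/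
def diffIndex {n : ℕ} (j : Fin n) (i : Fin (j : ℕ)) : GenIndex n :=
  ⟨(j : ℕ) - (i : ℕ), by have := i.isLt; have := j.isLt; omega⟩

/-- `F_Λ(z_1, …, z_n)`: the product of the `F_{j-i}(q^{2c_i(Λ)} z_i, q^{2c_j(Λ)} z_j)` over all
pairs `i < j`, ordered from left to right by increasing `j` and, for the same `j`, by
increasing `i`. -/
noncomputable def StandardTableau.bigF {n : ℕ} {μ : YoungDiagram} (Λ : StandardTableau n μ)
    (z : Fin n → Cq) : Hecke n :=
  (List.ofFn fun j : Fin n =>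
    (List.ofFn fun i : Fin (j : ℕ) =>
      F (diffIndex j i) (Λ.arg z (Fin.castLE j.isLt.le i)) (Λ.arg z j)).prod).prod

/-- The set of all `z` at which every factor of `F_Λ(z_1, …, z_n)` is defined, the
complement of finitely many hyperplanes. -/
def StandardTableau.domain {n : ℕ} {μ : YoungDiagram} (Λ : StandardTableau n μ) :
    Set (Fin n → Cq) :=
  {z | ∀ i j : Fin n, i < j → Λ.arg z i ≠ 0 ∧ Λ.arg z i ≠ Λ.arg z j}

/-! ### Regularity of a vector-valued rational function on a subspace -/

/-- `P : ℂ(q)^n → A` is a polynomial map with values in the vector space `A`, i.e. a finite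
sum of polynomials times fixed vectors. -/
def IsPolynomialMap {n : ℕ} {A : Type*} [AddCommGroup A] [Module Cq A]
    (P : (Fin n → Cq) → A) : Prop :=
  ∃ (N : ℕ) (f : Fin N → MvPolynomial (Fin n) Cq) (v : Fin N → A),
    ∀ z, P z = ∑ k, MvPolynomial.eval z (f k) • v k

/-- Let `Φ` be a function given by a rational expression that is defined on `U`, the
complement of the zero set of a polynomial. The restriction of this rational function to the
subspace `V` (which makes sense when `U` meets `V`) is regular at the point `p` if it
can be written on `V` as a fraction `P / g`, with a vector-valued polynomial `P` and a scalar
polynomial `g` that does not vanish at `p`. Two rational functions on `V` (a vector space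
over an infinite field) are equal when they agree on the nonempty Zariski open set `V ∩ U`. -/
def RestrictionRegularAt {n : ℕ} {A : Type*} [AddCommGroup A] [Module Cq A]
    (V : Submodule Cq (Fin n → Cq)) (U : Set (Fin n → Cq)) (Φ : (Fin n → Cq) → A)
    (p : Fin n → Cq) : Prop :=
  ∃ (g : MvPolynomial (Fin n) Cq) (P : (Fin n → Cq) → A),
    IsPolynomialMap P ∧ MvPolynomial.eval p g ≠ 0 ∧
      ∀ z ∈ V, z ∈ U → MvPolynomial.eval z g • Φ z = P z

end HookFusion

namespace HookFusion

/-! ### Identities in an arbitrary algebra over a field -/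

section Generic

variable {K A : Type*} [Field K] [Ring A] [Algebra K A]

/-! At a point with all `z_a` equal, a factor can have a pole only if its two boxes have equal
content, i.e. lie on one diagonal. The proof orders the boxes so that every such pole can be
cancelled.

For any ordering of the boxes there is an analogous ordered product. By the Yang–Baxter relation,
exchanging two consecutive boxes with arguments `a`, `b` intertwines the two products
(`triProd_mul_baxter`), up to factors `F(a, b)` and `F(b, a)`. The product of these two is the
scalar `(a - q²b)(a - q⁻²b)/(a - b)²`. If the contents differ by more than one, everything involved
is regular and the scalar is nonzero at the point, so regularity transfers (`regularOn_of_swap`).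
Incomparable boxes satisfy this condition, so every standard tableau reduces to the order that runs
through the principal hooks one after another.

In that order a box producing a pole is followed at once by its neighbour in the same hook
(`exists_root_of_content_eq`). On the hook subspace the ratio of their arguments is `r²` with `r =
q` or `r = -q⁻¹`. The product built so far is then right divisible by the quasi-idempotent `T_k +
r⁻¹`, which may be inserted at the cost of the nonzero scalar `r + r⁻¹`. Moved next to the singular
factor and its successor, it cancels the pole (`projGen_mul_baxter_mul_baxter`). -/

lemma mul_self_of_quadratic {p : K} (hp : p ≠ 0) {t : A}
    (h : (t - algebraMap K A p) * (t + algebraMap K A p⁻¹) = 0) :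
    t * t = (p - p⁻¹) • t + 1 := by
  simp only [Algebra.algebraMap_eq_smul_one, sub_mul, mul_add, smul_mul_assoc, one_mul,
    mul_smul_comm, mul_one, smul_sub, smul_smul, inv_mul_cancel₀ hp, one_smul] at h
  have : t * t = (t * t - p • t + (p⁻¹ • t - 1)) + (p - p⁻¹) • t + 1 := by module
  rw [this, h, zero_add]

/-- After expansion, only the coefficients of `s` and `t` differ between the two sides, and `h` is
exactly their equality. -/
lemma yang_of_coefficients {d x y z : K} {s t : A} (hs : s * s = d • s + 1)
    (ht : t * t = d • t + 1) (hst : s * t * s = t * s * t) (h : y * (d + x + z) = x * z) :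
    (s + algebraMap K A x) * (t + algebraMap K A y) * (s + algebraMap K A z) =
      (t + algebraMap K A z) * (s + algebraMap K A y) * (t + algebraMap K A x) := by
  have e : y * d = x * z - y * x - y * z := by linear_combination h
  simp only [Algebra.algebraMap_eq_smul_one, add_mul, mul_add, smul_mul_assoc, one_mul,
    mul_smul_comm, mul_one, smul_smul, hs, ht, hst, smul_add, e]
  module

lemma smul_mul_of_coefficients {d x y u v : K} {s : A} (hs : s * s = d • s + 1)
    (hy : y = -d - x) (huv : u * (1 + y * x) = v) :
    u • ((s + algebraMap K A y) * (s + algebraMap K A x)) = v • (1 : A) := by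
  subst hy
  simp only [Algebra.algebraMap_eq_smul_one, add_mul, mul_add, smul_mul_assoc, one_mul,
    mul_smul_comm, mul_one, hs, ← huv]
  module

lemma add_inv_mul_of_quadratic {r : K} (hr : r ≠ 0) {s : A} (hs : s * s = (r - r⁻¹) • s + 1) :
    (s + algebraMap K A r⁻¹) * s = r • (s + algebraMap K A r⁻¹) := by
  rw [add_mul, hs]
  simp only [Algebra.algebraMap_eq_smul_one, smul_mul_assoc, one_mul, smul_add, smul_smul,
    mul_inv_cancel₀ hr]
  module

end Generic

/-! ### Relations in the Hecke algebra -/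

lemma q_ne_zero : q ≠ 0 := RatFunc.X_ne_zero

lemma q_pow_injective : Function.Injective (fun k : ℕ => q ^ k) := by
  intro a b h
  have h1 : algebraMap (Polynomial ℂ) Cq (Polynomial.X ^ a) =
      algebraMap (Polynomial ℂ) Cq (Polynomial.X ^ b) := by
    simpa [q] using h
  have h2 := congrArg Polynomial.natDegree (RatFunc.algebraMap_injective ℂ h1)
  simpa using h2

lemma q_zpow_injective : Function.Injective (fun k : ℤ => q ^ k) := by
  have key : ∀ k : ℤ, q ^ k = 1 → k = 0 := by
    intro k h
    obtain ⟨m, rfl | rfl⟩ := k.eq_nat_or_neg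
    · have : q ^ m = q ^ 0 := by simpa using h
      simpa using q_pow_injective this
    · have : q ^ m = q ^ 0 := by simpa using h
      simpa using q_pow_injective this
  intro a b h
  have : q ^ (a - b) = 1 := by
    rw [zpow_sub₀ q_ne_zero]
    exact (div_eq_one_iff_eq (zpow_ne_zero _ q_ne_zero)).2 h
  linarith [key _ this]

/-- The generator `T_k`, extended by zero to all natural numbers `k`. -/
noncomputable def gen (n k : ℕ) : Hecke n :=
  if h : 1 ≤ k ∧ k < n then T ⟨k, h⟩ else 0

/-- The scalar part of `F_k(a, b)`. -/
noncomputable def coef (a b : Cq) : Cq := (q - q⁻¹) / (a⁻¹ * b - 1)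

/-- The element `F_k(a, b)`, for an arbitrary natural number `k`. -/
noncomputable def baxter (n k : ℕ) (a b : Cq) : Hecke n :=
  gen n k + algebraMap Cq (Hecke n) (coef a b)

lemma gen_mul_self {n k : ℕ} (h1 : 1 ≤ k) (h2 : k < n) :
    gen n k * gen n k = (q - q⁻¹) • gen n k + 1 := by
  have h := RingQuot.mkAlgHom_rel Cq (HeckeRel.quadratic (n := n) ⟨k, h1, h2⟩)
  simp only [map_mul, map_sub, map_add, map_zero, AlgHom.commutes] at h
  change (T _ - _) * (T _ + _) = 0 at h
  simp only [gen, h1, h2, and_self, dif_pos]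
  exact mul_self_of_quadratic q_ne_zero h

lemma gen_braid {n k : ℕ} (h1 : 1 ≤ k) (h2 : k + 1 < n) :
    gen n k * gen n (k + 1) * gen n k = gen n (k + 1) * gen n k * gen n (k + 1) := by
  have h := RingQuot.mkAlgHom_rel Cq
    (HeckeRel.braid (n := n) ⟨k, h1, by omega⟩ ⟨k + 1, by omega, h2⟩ rfl)
  simp only [map_mul] at h
  have e1 : 1 ≤ k ∧ k < n := ⟨h1, by omega⟩
  have e2 : 1 ≤ k + 1 ∧ k + 1 < n := ⟨by omega, h2⟩
  simp only [gen, e1, e2, and_self, dif_pos]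
  exact h

/-- No range condition is needed, because the default value `0` commutes with everything. -/
lemma gen_comm {n k l : ℕ} (h : k + 1 < l) : Commute (gen n k) (gen n l) := by
  unfold gen
  split_ifs with h1 h2
  · have := RingQuot.mkAlgHom_rel Cq (HeckeRel.comm (n := n) ⟨k, h1⟩ ⟨l, h2⟩ h)
    simp only [map_mul] at this
    exact this
  all_goals simp

lemma baxter_comm {n k l : ℕ} (h : k + 1 < l ∨ l + 1 < k) (a b c d : Cq) :
    Commute (baxter n k a b) (baxter n l c d) := by
  have : Commute (gen n k) (gen n l) := by
    rcases h with h | h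
    · exact gen_comm h
    · exact (gen_comm h).symm
  unfold baxter
  exact (this.add_left (Algebra.commutes _ _)).add_right
    ((Algebra.commutes _ _).symm : Commute _ _)

lemma coef_eq {a b : Cq} (ha : a ≠ 0) : coef a b = (q - q⁻¹) * a / (b - a) := by
  unfold coef
  -- Here both sides are quotients by zero, hence zero.
  by_cases hab : b - a = 0
  · have : b = a := sub_eq_zero.1 hab
    subst this
    simp [ha]
  · have : a⁻¹ * b - 1 = (b - a) / a := by field_simp
    rw [this, div_div_eq_mul_div]

lemma coef_relation {a b c : Cq} (ha : a ≠ 0) (hb : b ≠ 0) (hab : a ≠ b) (hac : a ≠ c)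
    (hbc : b ≠ c) :
    coef a c * (q - q⁻¹ + coef a b + coef b c) = coef a b * coef b c := by
  rw [coef_eq ha, coef_eq ha, coef_eq hb]
  have h1 : b - a ≠ 0 := sub_ne_zero.2 hab.symm
  have h2 : c - a ≠ 0 := sub_ne_zero.2 hac.symm
  have h3 : c - b ≠ 0 := sub_ne_zero.2 hbc.symm
  generalize q - q⁻¹ = d
  field_simp
  ring

/-- The Yang–Baxter relation. -/
lemma baxter_yang {n k : ℕ} (h1 : 1 ≤ k) (h2 : k + 1 < n) {a b c : Cq} (ha : a ≠ 0)
    (hb : b ≠ 0) (hab : a ≠ b) (hac : a ≠ c) (hbc : b ≠ c) :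
    baxter n k a b * baxter n (k + 1) a c * baxter n k b c =
      baxter n (k + 1) b c * baxter n k a c * baxter n (k + 1) a b := by
  have hs := gen_mul_self h1 (show k < n by omega)
  have ht := gen_mul_self (n := n) (k := k + 1) (by omega) h2
  have hst := gen_braid h1 h2
  have hc := coef_relation ha hb hab hac hbc
  exact yang_of_coefficients hs ht hst hc

/-- The two scalar parts add up to `-(q - q⁻¹)`, which kills the term in `T_k`. With denominators
cleared, the remaining scalar vanishes only for `a = q^{±2} b`. -/
lemma baxter_mul_swap {n k : ℕ} (h1 : 1 ≤ k) (h2 : k < n) {a b : Cq} (ha : a ≠ 0)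
    (hb : b ≠ 0) (hab : a ≠ b) :
    (a - b) ^ 2 • (baxter n k b a * baxter n k a b) =
      ((a - q ^ 2 * b) * (a - q⁻¹ ^ 2 * b)) • (1 : Hecke n) := by
  have hs := gen_mul_self h1 h2
  have h3 : a - b ≠ 0 := sub_ne_zero.2 hab
  have h4 : b - a ≠ 0 := sub_ne_zero.2 hab.symm
  have e1 : coef b a = -(q - q⁻¹) - coef a b := by
    rw [coef_eq ha, coef_eq hb]
    generalize q - q⁻¹ = d
    field_simp
    ring
  have e2 : (a - b) ^ 2 * (1 + (-(q - q⁻¹) - coef a b) * coef a b) =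
      (a - q ^ 2 * b) * (a - q⁻¹ ^ 2 * b) := by
    rw [coef_eq ha]
    have := q_ne_zero
    field_simp
    ring
  rw [← e1] at e2
  exact smul_mul_of_coefficients hs e1 e2

/-! ### Ordered products -/

/-- The product of the `F_{d-i}(a_i, x)` over `0 ≤ i < l`, from left to right. -/
noncomputable def rowProd (n : ℕ) (a : ℕ → Cq) (d : ℕ) (x : Cq) : ℕ → Hecke n
  | 0 => 1
  | l + 1 => rowProd n a d x l * baxter n (d - l) (a l) x

/-- The product of the `F_{j-i}(a_i, a_j)` over `0 ≤ i < j < m`. -/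
noncomputable def triProd (n : ℕ) (a : ℕ → Cq) : ℕ → Hecke n
  | 0 => 1
  | m + 1 => triProd n a m * rowProd n a m (a m) m

/-- The sequence `a` with the terms of index `i` and `i + 1` exchanged. -/
def swapSeq (a : ℕ → Cq) (i : ℕ) : ℕ → Cq := a ∘ Equiv.swap i (i + 1)

lemma swapSeq_left (a : ℕ → Cq) (i : ℕ) : swapSeq a i i = a (i + 1) := by
  simp [swapSeq]

lemma swapSeq_right (a : ℕ → Cq) (i : ℕ) : swapSeq a i (i + 1) = a i := by
  simp [swapSeq]

lemma swapSeq_of_ne (a : ℕ → Cq) {i j : ℕ} (h : j ≠ i) (h' : j ≠ i + 1) :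
    swapSeq a i j = a j := by
  simp [swapSeq, Equiv.swap_apply_of_ne_of_ne h h']

lemma rowProd_congr (n : ℕ) {a b : ℕ → Cq} (d : ℕ) (x : Cq) {l : ℕ}
    (h : ∀ i < l, a i = b i) : rowProd n a d x l = rowProd n b d x l := by
  induction l with
  | zero => rfl
  | succ l ih =>
    rw [rowProd, rowProd, ih fun i hi => h i (by omega), h l (by omega)]

lemma triProd_congr (n : ℕ) {a b : ℕ → Cq} {m : ℕ}
    (h : ∀ i < m, a i = b i) : triProd n a m = triProd n b m := by
  induction m with
  | zero => rfl
  | succ m ih =>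
    rw [triProd, triProd, ih fun i hi => h i (by omega), h m (by omega),
      rowProd_congr n m (b m) fun i hi => h i (by omega)]

lemma gen_commute_rowProd (n : ℕ) (a : ℕ → Cq) {d k l : ℕ} (x : Cq) (h : k + l < d) :
    Commute (gen n k) (rowProd n a d x l) := by
  induction l with
  | zero => exact Commute.one_right _
  | succ l ih =>
    refine (ih (by omega)).mul_right ?_
    exact (gen_comm (by omega)).add_right (Algebra.commutes _ _).symm

lemma baxter_commute_rowProd (n : ℕ) (a : ℕ → Cq) {d k l : ℕ} (x y z : Cq) (h : k + l < d) :
    Commute (baxter n k y z) (rowProd n a d x l) :=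
  (gen_commute_rowProd n a x h).add_left (Algebra.commutes _ _)

lemma baxter_commute_triProd (n : ℕ) (a : ℕ → Cq) {k m : ℕ} (y z : Cq) (h : m < k) :
    Commute (baxter n k y z) (triProd n a m) := by
  induction m with
  | zero => exact Commute.one_right _
  | succ m ih =>
    refine (ih (by omega)).mul_right ?_
    have : ∀ l, Commute (baxter n k y z) (rowProd n a m (a m) l) := by
      intro l
      induction l with
      | zero => exact Commute.one_right _
      | succ l ihl => exact ihl.mul_right (baxter_comm (by omega) _ _ _ _)
    exact this m

/-- Yang–Baxter applies at the positions `i`, `i + 1` and raises the index of the travelling factor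
by one; all other factors of the row have index at distance at least two and commute with it. -/
lemma baxter_mul_rowProd {n : ℕ} {a : ℕ → Cq} {d i l : ℕ} {x : Cq} (hl : i + 2 ≤ l) (hld : l ≤ d)
    (hd : d < n) (h0 : a i ≠ 0) (h1 : a (i + 1) ≠ 0) (h01 : a i ≠ a (i + 1)) (h0x : a i ≠ x)
    (h1x : a (i + 1) ≠ x) :
    baxter n (d - 1 - i) (a i) (a (i + 1)) * rowProd n a d x l =
      rowProd n (swapSeq a i) d x l * baxter n (d - i) (a i) (a (i + 1)) := by
  induction l, hl using Nat.le_induction with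
  | base =>
    have hy := baxter_yang (n := n) (k := d - 1 - i) (by omega) (by omega) h0 h1 h01 h0x h1x
    have e : d - 1 - i + 1 = d - i := by omega
    have e' : d - (i + 1) = d - 1 - i := by omega
    have hc := baxter_commute_rowProd n a (d := d) (k := d - 1 - i) (l := i) x (a i) (a (i + 1))
      (by omega)
    rw [e] at hy
    have hr : rowProd n (swapSeq a i) d x i = rowProd n a d x i :=
      rowProd_congr n d x fun j hj => swapSeq_of_ne a (by omega) (by omega)
    simp only [rowProd, swapSeq_left, swapSeq_right, e', hr]
    rw [← mul_assoc, ← mul_assoc, hc.eq, mul_assoc, mul_assoc, ← mul_assoc (baxter n _ _ _), hy]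
    simp only [mul_assoc]
  | succ l hl ih =>
    rw [rowProd, rowProd, ← mul_assoc, ih (by omega), mul_assoc,
      (baxter_comm (by omega) _ _ _ _).eq, swapSeq_of_ne a (by omega) (by omega), mul_assoc]

/-- A factor `F(x, y)` entering on the right exchanges the parameters of two consecutive rows and
leaves on the left. Each `a_j` it passes costs one Yang–Baxter move and raises its index by one, so
`d` must vary in the induction. -/
lemma rowProd_mul_rowProd {n : ℕ} {a : ℕ → Cq} {x y : Cq} (hx : x ≠ 0) (hxy : x ≠ y) (i d : ℕ)
    (hd : i + d + 1 < n) (h0 : ∀ j < i, a j ≠ 0) (hax : ∀ j < i, a j ≠ x)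
    (hay : ∀ j < i, a j ≠ y) :
    rowProd n a (i + d) x i * rowProd n a (i + d + 1) y i * baxter n (d + 1) x y =
      baxter n (i + d + 1) x y * rowProd n a (i + d) y i * rowProd n a (i + d + 1) x i := by
  induction i generalizing d with
  | zero => simp [rowProd]
  | succ i ih =>
    have ih := ih (d + 1) (by omega) (fun j hj => h0 j (by omega)) (fun j hj => hax j (by omega))
      (fun j hj => hay j (by omega))
    have hy := baxter_yang (n := n) (k := d + 1) (a := a i) (b := x) (c := y) (by omega) (by omega)
      (h0 i (by omega)) hx (hax i (by omega)) (hay i (by omega)) hxy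
    have c1 : ∀ u v w, Commute (baxter n (d + 1) u v) (rowProd n a (i + (d + 1) + 1) w i) :=
      fun u v w => baxter_commute_rowProd n a w u v (by omega)
    have e1 : i + 1 + d = i + (d + 1) := by omega
    have e2 : i + (d + 1) - i = d + 1 := by omega
    have e3 : i + (d + 1) + 1 - i = d + 1 + 1 := by omega
    simp only [rowProd, e1, e2, e3]
    calc _ = rowProd n a (i + (d + 1)) x i *
          (baxter n (d + 1) (a i) x * rowProd n a (i + (d + 1) + 1) y i) *
            baxter n (d + 1 + 1) (a i) y * baxter n (d + 1) x y := by simp only [mul_assoc]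
      _ = rowProd n a (i + (d + 1)) x i * rowProd n a (i + (d + 1) + 1) y i *
          (baxter n (d + 1) (a i) x * baxter n (d + 1 + 1) (a i) y * baxter n (d + 1) x y) := by
        rw [(c1 _ _ _).eq]; simp only [mul_assoc]
      _ = (rowProd n a (i + (d + 1)) x i * rowProd n a (i + (d + 1) + 1) y i *
          baxter n (d + 1 + 1) x y) * baxter n (d + 1) (a i) y * baxter n (d + 1 + 1) (a i) x := by
        rw [hy]; simp only [mul_assoc]
      _ = baxter n (i + (d + 1) + 1) x y * rowProd n a (i + (d + 1)) y i *
          (rowProd n a (i + (d + 1) + 1) x i * baxter n (d + 1) (a i) y) *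
            baxter n (d + 1 + 1) (a i) x := by
        rw [ih]; simp only [mul_assoc]
      _ = _ := by rw [← (c1 _ _ _).eq]; simp only [mul_assoc]

/-- Exchanging two consecutive terms of the sequence in the ordered product. -/
lemma triProd_mul_baxter {n : ℕ} {a : ℕ → Cq} {i m : ℕ} (hm : i + 2 ≤ m) (hmn : m ≤ n)
    (h0 : ∀ j < n, a j ≠ 0) (hinj : ∀ j < n, ∀ k < n, j ≠ k → a j ≠ a k) :
    triProd n a m * baxter n (m - 1 - i) (a (i + 1)) (a i) =
      baxter n (i + 1) (a i) (a (i + 1)) * triProd n (swapSeq a i) m := by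
  induction m, hm using Nat.le_induction with
  | base =>
    have h := rowProd_mul_rowProd (n := n) (a := a) (x := a i) (y := a (i + 1)) (h0 i (by omega))
      (hinj _ (by omega) _ (by omega) (by omega)) i 0 (by omega) (fun j hj => h0 j (by omega))
      (fun j hj => hinj _ (by omega) _ (by omega) (by omega))
      (fun j hj => hinj _ (by omega) _ (by omega) (by omega))
    have hr : ∀ d x, rowProd n (swapSeq a i) d x i = rowProd n a d x i := fun d x =>
      rowProd_congr n d x fun j hj => swapSeq_of_ne a (by omega) (by omega)
    have ht : triProd n (swapSeq a i) i = triProd n a i :=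
      triProd_congr n fun j hj => swapSeq_of_ne a (by omega) (by omega)
    have hc := baxter_commute_triProd n a (k := i + 1) (m := i) (a i) (a (i + 1)) (by omega)
    have e1 : i + 2 - 1 - i = 1 := by omega
    have e2 : i + 1 - i = 1 := by omega
    simp only [add_zero, zero_add] at h
    simp only [triProd, rowProd, swapSeq_left, swapSeq_right, hr, ht, e1, e2]
    calc _ = triProd n a i * (rowProd n a i (a i) i * rowProd n a (i + 1) (a (i + 1)) i *
          baxter n 1 (a i) (a (i + 1))) * baxter n 1 (a (i + 1)) (a i) := by
            simp only [mul_assoc]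
      _ = triProd n a i * baxter n (i + 1) (a i) (a (i + 1)) * (rowProd n a i (a (i + 1)) i *
          rowProd n a (i + 1) (a i) i) * baxter n 1 (a (i + 1)) (a i) := by
            rw [h]; simp only [mul_assoc]
      _ = _ := by rw [← hc.eq]; simp only [mul_assoc]
  | succ m hm ih =>
    have e1 : m + 1 - 1 - i = m - i := by omega
    have hsw : swapSeq (swapSeq a i) i = a := by
      funext j; simp [swapSeq]
    -- The extra factor has its arguments in the order `a (i + 1)`, `a i`, so the row crossing is
    -- applied to the exchanged sequence.
    have h := baxter_mul_rowProd (n := n) (a := swapSeq a i) (d := m) (i := i) (l := m) (x := a m)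
      hm le_rfl (by omega)
      (by rw [swapSeq_left]; exact h0 _ (by omega))
      (by rw [swapSeq_right]; exact h0 _ (by omega))
      (by rw [swapSeq_left, swapSeq_right]; exact hinj _ (by omega) _ (by omega) (by omega))
      (by rw [swapSeq_left]; exact hinj _ (by omega) _ (by omega) (by omega))
      (by rw [swapSeq_right]; exact hinj _ (by omega) _ (by omega) (by omega))
    rw [swapSeq_left, swapSeq_right, hsw] at h
    rw [triProd, triProd, e1, swapSeq_of_ne a (by omega) (by omega), mul_assoc, ← h, ← mul_assoc,
      ih (by omega), mul_assoc]

/-- A factor belonging to two consecutive terms can be split off on the right. -/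
lemma exists_triProd_eq_mul_baxter {n : ℕ} {a : ℕ → Cq} {i m : ℕ} (hm : i + 2 ≤ m) (hmn : m ≤ n)
    (h0 : ∀ j < n, a j ≠ 0) (hinj : ∀ j < n, ∀ k < n, j ≠ k → a j ≠ a k) :
    ∃ x, triProd n a m = x * baxter n (m - 1 - i) (a i) (a (i + 1)) := by
  induction m, hm using Nat.le_induction with
  | base =>
    have e1 : i + 2 - 1 - i = i + 1 - i := by omega
    rw [e1]
    exact ⟨triProd n a (i + 1) * rowProd n a (i + 1) (a (i + 1)) i, by
      simp only [triProd, rowProd, mul_assoc]⟩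
  | succ m hm ih =>
    obtain ⟨x, hx⟩ := ih (by omega)
    have e1 : m + 1 - 1 - i = m - i := by omega
    refine ⟨x * rowProd n (swapSeq a i) m (a m) m, ?_⟩
    rw [triProd, hx, mul_assoc, baxter_mul_rowProd hm le_rfl (by omega) (h0 _ (by omega))
      (h0 _ (by omega)) (hinj _ (by omega) _ (by omega) (by omega))
      (hinj _ (by omega) _ (by omega) (by omega)) (hinj _ (by omega) _ (by omega) (by omega)),
      e1, mul_assoc]

/-! ### Quasi-idempotents and cancellation of a pole -/

/-- The two parameters `r` for which `(T_k - r)(T_k + r⁻¹) = 0`. -/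
def IsHeckeRoot (r : Cq) : Prop := r = q ∨ r = -q⁻¹

lemma IsHeckeRoot.ne_zero {r : Cq} (hr : IsHeckeRoot r) : r ≠ 0 := by
  rcases hr with rfl | rfl
  · exact q_ne_zero
  · simpa using q_ne_zero

lemma IsHeckeRoot.sub_inv {r : Cq} (hr : IsHeckeRoot r) : r - r⁻¹ = q - q⁻¹ := by
  rcases hr with rfl | rfl
  · rfl
  · have := q_ne_zero; field_simp; ring

lemma q_sq_ne_one : q ^ 2 ≠ 1 := by
  intro h
  have : q ^ 2 = q ^ 0 := by simpa using h
  have := q_pow_injective this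
  omega

lemma IsHeckeRoot.sq_ne_one {r : Cq} (hr : IsHeckeRoot r) : r ^ 2 ≠ 1 := by
  have := q_sq_ne_one
  rcases hr with rfl | rfl
  · exact this
  · simpa using this

lemma IsHeckeRoot.sq_ne_neg_one {r : Cq} (hr : IsHeckeRoot r) : r ^ 2 + 1 ≠ 0 := by
  have h : q ^ 2 + 1 ≠ 0 := by
    intro h
    have h4 : q ^ 4 = q ^ 0 := by linear_combination (q ^ 2 - 1) * h
    have := q_pow_injective h4
    omega
  rcases hr with rfl | rfl
  · exact h
  · intro h'
    apply h
    have := q_ne_zero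
    field_simp at h'
    linear_combination h'

/-- The value `T_k + r⁻¹` of `F_k(a, r² a)`. -/
noncomputable def projGen (n k : ℕ) (r : Cq) : Hecke n := gen n k + algebraMap Cq (Hecke n) r⁻¹

lemma projGen_mul_gen {n k : ℕ} (h1 : 1 ≤ k) (h2 : k < n) {r : Cq} (hr : IsHeckeRoot r) :
    projGen n k r * gen n k = r • projGen n k r := by
  have hs := gen_mul_self h1 h2
  rw [← hr.sub_inv] at hs
  exact add_inv_mul_of_quadratic hr.ne_zero hs

lemma projGen_mul_self {n k : ℕ} (h1 : 1 ≤ k) (h2 : k < n) {r : Cq} (hr : IsHeckeRoot r) :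
    projGen n k r * projGen n k r = (r + r⁻¹) • projGen n k r := by
  conv_lhs => rw [projGen.eq_1 n k r, mul_add, ← projGen.eq_1, projGen_mul_gen h1 h2 hr]
  simp only [Algebra.algebraMap_eq_smul_one, mul_smul_comm, mul_one, add_smul]

lemma baxter_eq_projGen {n k : ℕ} {r a : Cq} (hr : IsHeckeRoot r) (ha : a ≠ 0) :
    baxter n k a (r ^ 2 * a) = projGen n k r := by
  have h1 := hr.sq_ne_one
  have h2 := hr.ne_zero
  have h3 : r ^ 2 * a - a = (r ^ 2 - 1) * a := by ring
  have h4 : r ^ 2 - 1 ≠ 0 := sub_ne_zero.2 h1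
  have e : coef a (r ^ 2 * a) = r⁻¹ := by
    rw [coef_eq ha, ← hr.sub_inv, h3]
    field_simp
  rw [baxter, e, projGen]

lemma triProd_mul_projGen {n : ℕ} {a : ℕ → Cq} {i m : ℕ} {r : Cq} (hr : IsHeckeRoot r)
    (hm : i + 2 ≤ m) (hmn : m ≤ n)
    (h0 : ∀ j < n, a j ≠ 0) (hinj : ∀ j < n, ∀ k < n, j ≠ k → a j ≠ a k)
    (hi : a (i + 1) = r ^ 2 * a i) :
    triProd n a m * projGen n (m - 1 - i) r = (r + r⁻¹) • triProd n a m := by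
  obtain ⟨x, hx⟩ := exists_triProd_eq_mul_baxter hm hmn h0 hinj
  rw [hi, baxter_eq_projGen hr (h0 _ (by omega))] at hx
  rw [hx, mul_assoc, projGen_mul_self (by omega) (by omega) hr, mul_smul_comm]

/-- The factor `T_k + r⁻¹` cancels the pole of `F_{k+1}(a, c) F_k(r² a, c)` at `a = c`. -/
lemma projGen_mul_baxter_mul_baxter {n k : ℕ} (h1 : 1 ≤ k) (h2 : k < n) {r a c : Cq}
    (hr : IsHeckeRoot r) (ha : a ≠ 0) (hac : a ≠ c) (hbc : r ^ 2 * a ≠ c) :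
    projGen n k r * baxter n (k + 1) a c * baxter n k (r ^ 2 * a) c =
      projGen n k r * gen n (k + 1) * baxter n k (r ^ 2 * a) c +
        algebraMap Cq (Hecke n) (r * (q - q⁻¹) * a / (c - r ^ 2 * a)) * projGen n k r := by
  have h := projGen_mul_gen h1 h2 hr
  have h3 := hr.ne_zero
  have h4 : c - a ≠ 0 := sub_ne_zero.2 hac.symm
  have h5 : c - r ^ 2 * a ≠ 0 := sub_ne_zero.2 hbc.symm
  have e : projGen n k r * baxter n k (r ^ 2 * a) c =
      (r + coef (r ^ 2 * a) c) • projGen n k r := by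
    rw [baxter, mul_add, h]
    simp only [Algebra.algebraMap_eq_smul_one, mul_smul_comm, mul_one, add_smul]
  -- Here `r + coef (r² a) c = r (c - a) / (c - r² a)`, whose zero at `c = a` absorbs the pole of
  -- `coef a c`.
  have e' : coef a c * (r + coef (r ^ 2 * a) c) = r * (q - q⁻¹) * a / (c - r ^ 2 * a) := by
    rw [coef_eq ha, coef_eq (mul_ne_zero (pow_ne_zero 2 h3) ha), ← hr.sub_inv]
    field_simp
    ring
  rw [baxter.eq_1 n (k + 1), mul_add, add_mul, ← e']
  congr 1
  simp only [Algebra.algebraMap_eq_smul_one, mul_smul_comm, mul_one, smul_mul_assoc, e, smul_smul,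
    one_mul]

/-! ### Functions that are regular at a point -/

section Regular

variable {n : ℕ} {A : Type*}

lemma isPolynomialMap_of_fintype [AddCommGroup A] [Module Cq A] {ι : Type*} [Fintype ι]
    {P : (Fin n → Cq) → A} (f : ι → MvPolynomial (Fin n) Cq) (v : ι → A)
    (h : ∀ z, P z = ∑ k, MvPolynomial.eval z (f k) • v k) : IsPolynomialMap P := by
  refine ⟨Fintype.card ι, f ∘ (Fintype.equivFin ι).symm, v ∘ (Fintype.equivFin ι).symm, fun z => ?_⟩
  rw [h z]
  exact ((Fintype.equivFin ι).symm.sum_comp fun k => MvPolynomial.eval z (f k) • v k).symm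

lemma IsPolynomialMap.smul [AddCommGroup A] [Module Cq A] {P : (Fin n → Cq) → A}
    (hP : IsPolynomialMap P) (g : MvPolynomial (Fin n) Cq) :
    IsPolynomialMap fun z => MvPolynomial.eval z g • P z := by
  obtain ⟨N, f, v, h⟩ := hP
  exact ⟨N, fun k => g * f k, v, fun z => by simp [h, Finset.smul_sum, mul_smul]⟩

lemma IsPolynomialMap.add [AddCommGroup A] [Module Cq A] {P Q : (Fin n → Cq) → A}
    (hP : IsPolynomialMap P) (hQ : IsPolynomialMap Q) : IsPolynomialMap fun z => P z + Q z := by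
  obtain ⟨N, f, v, h⟩ := hP
  obtain ⟨M, f', v', h'⟩ := hQ
  exact isPolynomialMap_of_fintype (Sum.elim f f') (Sum.elim v v') fun z => by simp [h, h']

lemma IsPolynomialMap.mul [Ring A] [Algebra Cq A] {P Q : (Fin n → Cq) → A}
    (hP : IsPolynomialMap P) (hQ : IsPolynomialMap Q) : IsPolynomialMap fun z => P z * Q z := by
  obtain ⟨N, f, v, h⟩ := hP
  obtain ⟨M, f', v', h'⟩ := hQ
  refine isPolynomialMap_of_fintype (fun k : Fin N × Fin M => f k.1 * f' k.2)
    (fun k => v k.1 * v' k.2) fun z => ?_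
  simp only [h, h', Finset.sum_mul_sum, Fintype.sum_prod_type, smul_mul_smul_comm, map_mul]

/-- On the set `W`, the function `Φ` is a fraction whose denominator does not vanish at `p`. -/
def RegularOn [AddCommGroup A] [Module Cq A] (W : Set (Fin n → Cq)) (p : Fin n → Cq)
    (Φ : (Fin n → Cq) → A) : Prop :=
  ∃ (g : MvPolynomial (Fin n) Cq) (P : (Fin n → Cq) → A),
    IsPolynomialMap P ∧ MvPolynomial.eval p g ≠ 0 ∧ ∀ z ∈ W, MvPolynomial.eval z g • Φ z = P z

variable {W : Set (Fin n → Cq)} {p : Fin n → Cq}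

/-- Scalars nonvanishing at `p` can be divided out. This removes both the scalar arising from an
exchange of boxes and the factor `r + r⁻¹`. -/
lemma RegularOn.of_smul_eq [AddCommGroup A] [Module Cq A] {Φ Ψ : (Fin n → Cq) → A}
    (hΨ : RegularOn W p Ψ) (h k : MvPolynomial (Fin n) Cq) (hp : MvPolynomial.eval p h ≠ 0)
    (heq : ∀ z ∈ W, MvPolynomial.eval z h • Φ z = MvPolynomial.eval z k • Ψ z) :
    RegularOn W p Φ := by
  obtain ⟨g, P, hP, hg, hgP⟩ := hΨ
  refine ⟨g * h, _, hP.smul k, by simp [hg, hp], fun z hz => ?_⟩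
  rw [map_mul, mul_smul, heq z hz, smul_comm, hgP z hz]

lemma RegularOn.congr [AddCommGroup A] [Module Cq A] {Φ Ψ : (Fin n → Cq) → A}
    (hΨ : RegularOn W p Ψ) (h : ∀ z ∈ W, Φ z = Ψ z) : RegularOn W p Φ :=
  hΨ.of_smul_eq 1 1 (by simp) fun z hz => by rw [h z hz]

/-- Regularity may be tested away from a hypersurface not containing the point. -/
lemma RegularOn.extend [AddCommGroup A] [Module Cq A] {W' : Set (Fin n → Cq)}
    {Φ : (Fin n → Cq) → A} (hΦ : RegularOn W p Φ) (h : MvPolynomial (Fin n) Cq)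
    (hp : MvPolynomial.eval p h ≠ 0) (hW : ∀ z ∈ W', MvPolynomial.eval z h ≠ 0 → z ∈ W) :
    RegularOn W' p Φ := by
  obtain ⟨g, P, hP, hg, hgP⟩ := hΦ
  refine ⟨h * g, _, hP.smul h, by simp [hg, hp], fun z hz => ?_⟩
  rw [map_mul, mul_smul]
  by_cases h0 : MvPolynomial.eval z h = 0
  · simp [h0]
  · rw [hgP z (hW z hz h0)]

lemma RegularOn.add [AddCommGroup A] [Module Cq A] {Φ Ψ : (Fin n → Cq) → A}
    (hΦ : RegularOn W p Φ) (hΨ : RegularOn W p Ψ) : RegularOn W p fun z => Φ z + Ψ z := by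
  obtain ⟨g, P, hP, hg, hgP⟩ := hΦ
  obtain ⟨k, Q, hQ, hk, hkQ⟩ := hΨ
  refine ⟨g * k, _, (hP.smul k).add (hQ.smul g), by simp [hg, hk], fun z hz => ?_⟩
  rw [← hgP z hz, ← hkQ z hz, map_mul, smul_add, smul_smul, smul_smul,
    mul_comm (MvPolynomial.eval z k)]

lemma RegularOn.mul [Ring A] [Algebra Cq A] {Φ Ψ : (Fin n → Cq) → A}
    (hΦ : RegularOn W p Φ) (hΨ : RegularOn W p Ψ) : RegularOn W p fun z => Φ z * Ψ z := by
  obtain ⟨g, P, hP, hg, hgP⟩ := hΦ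
  obtain ⟨k, Q, hQ, hk, hkQ⟩ := hΨ
  refine ⟨g * k, _, hP.mul hQ, by simp [hg, hk], fun z hz => ?_⟩
  rw [← hgP z hz, ← hkQ z hz, map_mul, smul_mul_smul_comm]

lemma regularOn_const [AddCommGroup A] [Module Cq A] (x : A) :
    RegularOn W p fun _ => x :=
  ⟨1, _, isPolynomialMap_of_fintype (fun _ : Unit => 1) (fun _ => x) (fun _ => rfl), by simp,
    by simp⟩

lemma regularOn_algebraMap [Ring A] [Algebra Cq A] {s : (Fin n → Cq) → Cq}
    (g f : MvPolynomial (Fin n) Cq) (hg : MvPolynomial.eval p g ≠ 0)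
    (h : ∀ z ∈ W, MvPolynomial.eval z g * s z = MvPolynomial.eval z f) :
    RegularOn W p fun z => algebraMap Cq A (s z) :=
  ⟨g, _, isPolynomialMap_of_fintype (fun _ : Unit => f) (fun _ => 1) (fun _ => rfl), hg,
    fun z hz => by simp [Algebra.algebraMap_eq_smul_one, smul_smul, h z hz]⟩

/-- Regularity of `F_k(a, b)` where `b - a` does not vanish. -/
lemma regularOn_baxter (k : ℕ) (a b : MvPolynomial (Fin n) Cq)
    (hp : MvPolynomial.eval p b - MvPolynomial.eval p a ≠ 0)
    (h0 : ∀ z ∈ W, MvPolynomial.eval z a ≠ 0)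
    (h1 : ∀ z ∈ W, MvPolynomial.eval z b - MvPolynomial.eval z a ≠ 0) :
    RegularOn W p fun z =>
      baxter n k (MvPolynomial.eval z a) (MvPolynomial.eval z b) := by
  refine (regularOn_const (gen n k)).add (regularOn_algebraMap (b - a)
    (MvPolynomial.C (q - q⁻¹) * a) (by simpa using hp) fun z hz => ?_)
  rw [coef_eq (h0 z hz)]
  have := h1 z hz
  simp only [map_sub, map_mul, MvPolynomial.eval_C]
  field_simp

/-- The only denominator left after the cancellation is `c - r² a`; at `p` itself `a = c` is
allowed. -/
lemma regularOn_projGen_mul_baxter_mul_baxter {k : ℕ} (hk1 : 1 ≤ k) (hk2 : k < n) {r : Cq}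
    (hr : IsHeckeRoot r) (a c : MvPolynomial (Fin n) Cq)
    (hp : MvPolynomial.eval p c - r ^ 2 * MvPolynomial.eval p a ≠ 0)
    (h0 : ∀ z ∈ W, MvPolynomial.eval z a ≠ 0)
    (h1 : ∀ z ∈ W, MvPolynomial.eval z a ≠ MvPolynomial.eval z c)
    (h2 : ∀ z ∈ W, MvPolynomial.eval z c - r ^ 2 * MvPolynomial.eval z a ≠ 0) :
    RegularOn W p fun z => projGen n k r * baxter n (k + 1) (MvPolynomial.eval z a)
      (MvPolynomial.eval z c) * baxter n k (r ^ 2 * MvPolynomial.eval z a)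
        (MvPolynomial.eval z c) := by
  have hb := regularOn_baxter (W := W) (p := p) k (MvPolynomial.C (r ^ 2) * a) c
    (by simpa only [map_mul, MvPolynomial.eval_C] using hp)
    (fun z hz => by
      simpa only [map_mul, MvPolynomial.eval_C] using
        mul_ne_zero (pow_ne_zero 2 hr.ne_zero) (h0 z hz))
    (fun z hz => by simpa only [map_mul, MvPolynomial.eval_C] using h2 z hz)
  have hs := regularOn_algebraMap (A := Hecke n) (W := W) (p := p)
    (s := fun z => r * (q - q⁻¹) * MvPolynomial.eval z a /
      (MvPolynomial.eval z c - r ^ 2 * MvPolynomial.eval z a))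
    (c - MvPolynomial.C (r ^ 2) * a) (MvPolynomial.C (r * (q - q⁻¹)) * a)
    (by simpa only [map_sub, map_mul, MvPolynomial.eval_C] using hp) fun z hz => by
      simp only [map_sub, map_mul, MvPolynomial.eval_C]
      exact mul_div_cancel₀ _ (h2 z hz)
  refine (((regularOn_const (projGen n k r * gen n (k + 1))).mul hb).add
    (hs.mul (regularOn_const (projGen n k r)))).congr fun z hz => ?_
  rw [projGen_mul_baxter_mul_baxter hk1 hk2 hr (h0 z hz) (h1 z hz)
    (fun h => h2 z hz (by rw [h, sub_self]))]
  simp only [map_mul, MvPolynomial.eval_C]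

end Regular

/-! ### The order of boxes along the principal hooks -/

/-- The boxes ordered by principal hook; within a hook, first the row and then the column. -/
def hookKey (x : ℕ × ℕ) : ℕ ×ₗ ℕ ×ₗ ℕ :=
  toLex (min x.1 x.2, toLex (if x.1 ≤ x.2 then 0 else 1, max x.1 x.2))

lemma hookKey_lt_iff (x y : ℕ × ℕ) : hookKey x < hookKey y ↔
    min x.1 x.2 < min y.1 y.2 ∨ min x.1 x.2 = min y.1 y.2 ∧
      ((if x.1 ≤ x.2 then 0 else 1) < (if y.1 ≤ y.2 then 0 else 1) ∨
        (if x.1 ≤ x.2 then 0 else 1) = (if y.1 ≤ y.2 then 0 else 1) ∧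
          max x.1 x.2 < max y.1 y.2) := by
  simp only [hookKey, Prod.Lex.toLex_lt_toLex]

lemma hookKey_injective : Function.Injective hookKey := by
  intro x y h
  have h1 := (hookKey_lt_iff x y).not.1 (by rw [h]; exact lt_irrefl _)
  have h2 := (hookKey_lt_iff y x).not.1 (by rw [h]; exact lt_irrefl _)
  obtain ⟨a, b⟩ := x
  obtain ⟨c, d⟩ := y
  ext <;> (simp only at *; split_ifs at * <;> omega)

/-- Hence the hook order is itself an order in which boxes may be added one by one. -/
lemma hookKey_strictMono : StrictMono hookKey := by
  intro x y h
  obtain ⟨a, b⟩ := x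
  obtain ⟨c, d⟩ := y
  rw [Prod.mk_lt_mk] at h
  rw [hookKey_lt_iff]
  simp only
  split_ifs <;> omega

lemma not_hookKey_between_right {a b : ℕ} (h : a ≤ b) (x : ℕ × ℕ)
    (h1 : hookKey (a, b) < hookKey x) : ¬ hookKey x < hookKey (a, b + 1) := by
  intro h2
  rw [hookKey_lt_iff] at h1 h2
  rcases le_or_gt x.1 x.2 with hx | hx
  · simp only [h, hx, h.trans (Nat.le_succ b), if_true, min_eq_left, max_eq_right] at h1 h2
    omega
  · simp only [h, hx.not_ge, hx.le, h.trans (Nat.le_succ b), if_true, if_false, min_eq_left,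
      max_eq_right, min_eq_right, max_eq_left] at h1 h2
    omega

lemma not_hookKey_between_down {a b : ℕ} (h : b < a) (x : ℕ × ℕ)
    (h1 : hookKey (a, b) < hookKey x) : ¬ hookKey x < hookKey (a + 1, b) := by
  intro h2
  have h' : b < a + 1 := by omega
  rw [hookKey_lt_iff] at h1 h2
  rcases le_or_gt x.1 x.2 with hx | hx
  · simp only [h.not_ge, h'.not_ge, h.le, h'.le, hx, if_true, if_false, min_eq_left, max_eq_right,
      min_eq_right, max_eq_left] at h1 h2
    omega
  · simp only [h.not_ge, h'.not_ge, h.le, h'.le, hx.not_ge, hx.le, if_false, max_eq_left,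
      min_eq_right] at h1 h2
    omega

/-! ### Reindexed ordered products -/

lemma rowProd_eq_ofFn (n : ℕ) (a : ℕ → Cq) (d : ℕ) (x : Cq) (l : ℕ) :
    rowProd n a d x l = (List.ofFn fun i : Fin l => baxter n (d - i) (a i) x).prod := by
  induction l with
  | zero => rfl
  | succ l ih =>
    rw [rowProd, ih, List.ofFn_succ', List.concat_eq_append, List.prod_append, List.prod_singleton]
    rfl

lemma triProd_eq_ofFn (n : ℕ) (a : ℕ → Cq) (m : ℕ) :
    triProd n a m = (List.ofFn fun j : Fin m =>
      (List.ofFn fun i : Fin (j : ℕ) => baxter n (j - i) (a i) (a j)).prod).prod := by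
  induction m with
  | zero => rfl
  | succ m ih =>
    rw [triProd, ih, rowProd_eq_ofFn, List.ofFn_succ', List.concat_eq_append, List.prod_append,
      List.prod_singleton]
    rfl

namespace StandardTableau

variable {n : ℕ} {μ : YoungDiagram} (Λ : StandardTableau n μ)

/-- The arguments of `F_Λ`, taken in the order given by a permutation. -/
noncomputable def argSeq (σ : Equiv.Perm (Fin n)) (z : Fin n → Cq) (i : ℕ) : Cq :=
  if h : i < n then Λ.arg z (σ ⟨i, h⟩) else 0

lemma argSeq_of_lt (σ : Equiv.Perm (Fin n)) (z : Fin n → Cq) {i : ℕ} (h : i < n) :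
    Λ.argSeq σ z i = Λ.arg z (σ ⟨i, h⟩) := dif_pos h

lemma argSeq_val (σ : Equiv.Perm (Fin n)) (z : Fin n → Cq) (i : Fin n) :
    Λ.argSeq σ z i = Λ.arg z (σ i) := dif_pos i.isLt

lemma bigF_eq (z : Fin n → Cq) : Λ.bigF z = triProd n (Λ.argSeq 1 z) n := by
  rw [triProd_eq_ofFn, bigF]
  congr 2
  funext j
  congr 2
  funext i
  have h : 1 ≤ (j : ℕ) - i ∧ (j : ℕ) - i < n := by
    have := i.isLt; have := j.isLt; omega
  rw [Λ.argSeq_of_lt 1 z (i.isLt.trans j.isLt), Λ.argSeq_of_lt 1 z j.isLt]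
  simp only [F, baxter, gen, h, and_self, dif_pos]
  rfl

lemma argSeq_mul_swap (σ : Equiv.Perm (Fin n)) (z : Fin n → Cq) {i : ℕ} (hi : i + 1 < n) :
    Λ.argSeq (σ * Equiv.swap ⟨i, by omega⟩ ⟨i + 1, hi⟩) z = swapSeq (Λ.argSeq σ z) i := by
  funext j
  by_cases h1 : j = i
  · subst h1
    rw [swapSeq_left, argSeq_of_lt _ _ _ (by omega), argSeq_of_lt _ _ _ hi]
    simp
  by_cases h2 : j = i + 1
  · subst h2
    rw [swapSeq_right, argSeq_of_lt _ _ _ hi, argSeq_of_lt _ _ _ (by omega)]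
    simp
  rw [swapSeq_of_ne _ h1 h2]
  unfold argSeq
  split_ifs with h
  · rw [Equiv.Perm.mul_apply, Equiv.swap_apply_of_ne_of_ne] <;> simp [h1, h2]
  · rfl

/-! ### Regularity under exchange of consecutive boxes -/

/-- The polynomial `q ^ (2 c_a) z_a`. -/
noncomputable def argPoly (a : Fin n) : MvPolynomial (Fin n) Cq :=
  MvPolynomial.C (q ^ (2 * Λ.content a)) * MvPolynomial.X a

lemma eval_argPoly (z : Fin n → Cq) (a : Fin n) :
    MvPolynomial.eval z (Λ.argPoly a) = Λ.arg z a := by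
  simp only [argPoly, arg, map_mul, MvPolynomial.eval_C, MvPolynomial.eval_X]

/-- The points of the hook subspace at which the arguments are nonzero and distinct. -/
def genericSet : Set (Fin n → Cq) :=
  {z | z ∈ Λ.hookSubspace ∧ (∀ a, Λ.arg z a ≠ 0) ∧ ∀ a b, a ≠ b → Λ.arg z a ≠ Λ.arg z b}

lemma const_mem_hookSubspace (y : Cq) : (fun _ => y) ∈ Λ.hookSubspace := fun _ _ _ => rfl

lemma zpow_mul_sub_ne_zero {y : Cq} (hy : y ≠ 0) {c d : ℤ} (h : c ≠ d) :
    q ^ (2 * c) * y - q ^ (2 * d) * y ≠ 0 := by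
  rw [← sub_mul]
  refine mul_ne_zero (sub_ne_zero.2 fun h' => h ?_) hy
  have := q_zpow_injective h'
  omega

lemma arg_const_sub_ne_zero {y : Cq} (hy : y ≠ 0) {a b : Fin n}
    (h : Λ.content a ≠ Λ.content b) : Λ.arg (fun _ => y) a - Λ.arg (fun _ => y) b ≠ 0 :=
  zpow_mul_sub_ne_zero hy h

lemma argSeq_ne_zero {z : Fin n → Cq} (hz : z ∈ Λ.genericSet) (σ : Equiv.Perm (Fin n)) :
    ∀ j < n, Λ.argSeq σ z j ≠ 0 := by
  intro j hj
  rw [argSeq_of_lt _ _ _ hj]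
  exact hz.2.1 _

lemma argSeq_ne {z : Fin n → Cq} (hz : z ∈ Λ.genericSet) (σ : Equiv.Perm (Fin n)) :
    ∀ j < n, ∀ k < n, j ≠ k → Λ.argSeq σ z j ≠ Λ.argSeq σ z k := by
  intro j hj k hk hjk
  rw [argSeq_of_lt _ _ _ hj, argSeq_of_lt _ _ _ hk]
  exact hz.2.2 _ _ (by simpa using hjk)

lemma regularOn_baxter_arg {y : Cq} (hy : y ≠ 0) (k : ℕ) {a b : Fin n}
    (h : Λ.content a ≠ Λ.content b) :
    RegularOn Λ.genericSet (fun _ => y) fun z => baxter n k (Λ.arg z a) (Λ.arg z b) := by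
  have := regularOn_baxter (W := Λ.genericSet) (p := fun _ => y) k (Λ.argPoly a) (Λ.argPoly b)
  simp only [eval_argPoly] at this
  refine this (Λ.arg_const_sub_ne_zero hy h.symm) (fun z hz => hz.2.1 a) fun z hz => ?_
  exact sub_ne_zero.2 (hz.2.2 _ _ fun hab => h (by rw [hab]))

/-- Exchanging two consecutive numbers preserves regularity if their contents differ by more
than one. -/
lemma regularOn_of_swap {y : Cq} (hy : y ≠ 0) (σ : Equiv.Perm (Fin n)) {i : ℕ} (hi : i + 1 < n)
    (hc : 1 < |Λ.content (σ ⟨i, by omega⟩) - Λ.content (σ ⟨i + 1, hi⟩)|)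
    (h : RegularOn Λ.genericSet (fun _ => y) fun z =>
      triProd n (Λ.argSeq (σ * Equiv.swap ⟨i, by omega⟩ ⟨i + 1, hi⟩) z) n) :
    RegularOn Λ.genericSet (fun _ => y) fun z => triProd n (Λ.argSeq σ z) n := by
  set a := σ ⟨i, by omega⟩ with ha
  set b := σ ⟨i + 1, hi⟩ with hb
  have hne : Λ.content a ≠ Λ.content b := by
    intro h; simp [h] at hc
  -- Contents differing by exactly one would make the scalar of `baxter_mul_swap` vanish at the
  -- point.
  have hne1 : Λ.content a ≠ 1 + Λ.content b := by
    intro h; simp [h] at hc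
  have hne2 : Λ.content a ≠ -1 + Λ.content b := by
    intro h; simp [h] at hc
  -- The right factor `F(a, b)` is there to turn the `F(b, a)` of the intertwining relation into a
  -- scalar.
  have hr := ((Λ.regularOn_baxter_arg hy (i + 1) hne).mul h).mul
    (Λ.regularOn_baxter_arg hy (n - 1 - i) hne)
  refine hr.of_smul_eq
    ((Λ.argPoly a - MvPolynomial.C (q ^ 2) * Λ.argPoly b) *
      (Λ.argPoly a - MvPolynomial.C (q⁻¹ ^ 2) * Λ.argPoly b))
    ((Λ.argPoly a - Λ.argPoly b) ^ 2) ?_ fun z hz => ?_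
  · simp only [map_mul, map_sub, MvPolynomial.eval_C, eval_argPoly, arg]
    refine mul_ne_zero ?_ ?_
    · convert zpow_mul_sub_ne_zero hy hne1 using 2
      rw [mul_add, zpow_add₀ q_ne_zero, mul_assoc]
      rfl
    · convert zpow_mul_sub_ne_zero hy hne2 using 2
      rw [mul_add, zpow_add₀ q_ne_zero, mul_assoc, inv_pow]
      rfl
  · have hab : a ≠ b := fun h => hne (by rw [h])
    have h1 := triProd_mul_baxter (n := n) (a := Λ.argSeq σ z) (i := i) (m := n) (by omega) le_rfl
      (Λ.argSeq_ne_zero hz σ) (Λ.argSeq_ne hz σ)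
    have h2 := baxter_mul_swap (n := n) (k := n - 1 - i) (by omega) (by omega)
      (hz.2.1 a) (hz.2.1 b) (hz.2.2 a b hab)
    rw [Λ.argSeq_of_lt σ z hi, Λ.argSeq_of_lt σ z (by omega : i < n), ← ha, ← hb] at h1
    simp only [map_mul, map_sub, map_pow, MvPolynomial.eval_C, eval_argPoly]
    rw [Λ.argSeq_mul_swap σ z hi, ← h1, mul_assoc, ← mul_smul_comm, h2, mul_smul_comm, mul_one]

/-! ### Regularity for the hook order -/

/-- In the order along principal hooks, a term producing a pole is followed immediately by its
neighbour in the same principal hook. -/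
lemma exists_root_of_content_eq {σ : Equiv.Perm (Fin n)}
    (hσ : StrictMono fun i => hookKey (Λ.box (σ i)).1) {i m : Fin n} (him : i < m)
    (hc : Λ.content (σ i) = Λ.content (σ m)) :
    ∃ j : Fin n, (j : ℕ) = i + 1 ∧ j < m ∧ Λ.content (σ j) ≠ Λ.content (σ m) ∧
      ∃ r, IsHeckeRoot r ∧ ∀ z ∈ Λ.hookSubspace, Λ.arg z (σ j) = r ^ 2 * Λ.arg z (σ i) := by
  have hlt := hσ him
  have hc' := hc
  simp only [content] at hc hlt
  have hmem := (Λ.box (σ m)).2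
  have hmemi := (Λ.box (σ i)).2
  rcases hx : (Λ.box (σ i)).1 with ⟨u, v⟩
  rcases hx' : (Λ.box (σ m)).1 with ⟨u', v'⟩
  rw [hx, hx'] at hc hlt
  rw [hx'] at hmem
  rw [hx] at hmemi
  simp only at hc
  -- Two boxes on one diagonal are comparable, and the later one cannot lie weakly to the upper
  -- left.
  have huu : u < u' := by
    by_contra hle
    have : ((u', v') : ℕ × ℕ) ≤ (u, v) := Prod.mk_le_mk.2 ⟨by omega, by omega⟩
    exact absurd hlt (not_lt.2 (hookKey_strictMono.monotone this))
  -- A box strictly between the two lies in the diagram; if no key separates it from `(u, v)`, it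
  -- occupies the next position.
  have main : ∀ x : ℕ × ℕ, (u, v) < x → x < (u', v') →
      (∀ w, hookKey (u, v) < hookKey w → ¬ hookKey w < hookKey x) →
      ∃ j : Fin n, (j : ℕ) = i + 1 ∧ j < m ∧ (Λ.box (σ j)).1 = x := by
    intro x hlx hxl hbet
    have hxm : x ∈ μ.cells := μ.isLowerSet hxl.le hmem
    set j := σ⁻¹ (Λ.box.symm ⟨x, hxm⟩) with hj
    have hbj : (Λ.box (σ j)).1 = x := by simp [hj]
    have hij : i < j := hσ.lt_iff_lt.1 (by
      simp only [hbj, hx]; exact hookKey_strictMono hlx)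
    have hjm : j < m := hσ.lt_iff_lt.1 (by
      simp only [hbj, hx']; exact hookKey_strictMono hxl)
    refine ⟨j, ?_, hjm, hbj⟩
    by_contra hne
    have hlt' : (i : ℕ) < j := hij
    have hn : (i : ℕ) + 1 < n := by omega
    have h1 := hσ (show i < ⟨i + 1, hn⟩ from Fin.lt_def.2 (by simp))
    have h2 := hσ (show (⟨i + 1, hn⟩ : Fin n) < j from Fin.lt_def.2 (by simp; omega))
    simp only [hx, hbj] at h1 h2
    exact hbet _ h1 h2
  have hmem' : ∀ j : Fin n, (Λ.box (σ j)).1 ∈ μ := fun j => (Λ.box (σ j)).2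
  by_cases huv : u ≤ v
  -- On or above the main diagonal the hook continues to the right, which raises the content and
  -- gives `r = q`; below it, the hook continues down, which gives `r = -q⁻¹`.
  · obtain ⟨j, hj, hjm, hbj⟩ := main (u, v + 1) (Prod.mk_lt_mk.2 (by omega))
      (Prod.mk_lt_mk.2 (by omega)) (not_hookKey_between_right huv)
    have hcj : Λ.content (σ j) = 1 + Λ.content (σ i) := by
      simp only [content, hbj, hx]; push_cast; ring
    refine ⟨j, hj, hjm, by omega, q, Or.inl rfl, fun z hz => ?_⟩
    have hs : Λ.SameHook (σ j) (σ i) := by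
      refine ⟨u, ⟨hmem' _, ?_⟩, ⟨hmem' _, ?_⟩⟩
      · rw [hbj]; left; exact ⟨rfl, by simp only; omega⟩
      · rw [hx]; left; exact ⟨rfl, huv⟩
    rw [arg, arg, hcj, hz _ _ hs, mul_add, zpow_add₀ q_ne_zero, mul_assoc]
    rfl
  · obtain ⟨j, hj, hjm, hbj⟩ := main (u + 1, v) (Prod.mk_lt_mk.2 (by omega))
      (Prod.mk_lt_mk.2 (by omega)) (not_hookKey_between_down (by omega))
    have hcj : Λ.content (σ j) = -1 + Λ.content (σ i) := by
      simp only [content, hbj, hx]; push_cast; ring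
    refine ⟨j, hj, hjm, by omega, -q⁻¹, Or.inr rfl, fun z hz => ?_⟩
    have hs : Λ.SameHook (σ j) (σ i) := by
      refine ⟨v, ⟨hmem' _, ?_⟩, ⟨hmem' _, ?_⟩⟩
      · rw [hbj]; right; exact ⟨rfl, by simp only; omega⟩
      · rw [hx]; right; exact ⟨rfl, by simp only; omega⟩
    rw [arg, arg, hcj, hz _ _ hs, mul_add, zpow_add₀ q_ne_zero, mul_assoc, neg_sq, inv_pow]
    rfl

/-- Regularity for the order along principal hooks. -/
lemma regularOn_of_strictMono {y : Cq} (hy : y ≠ 0) {σ : Equiv.Perm (Fin n)}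
    (hσ : StrictMono fun i => hookKey (Λ.box (σ i)).1) (m : ℕ) (hm : m ≤ n) :
    RegularOn Λ.genericSet (fun _ => y) fun z => triProd n (Λ.argSeq σ z) m := by
  induction m with
  | zero => exact regularOn_const 1
  | succ m ih =>
    have ih := ih (by omega)
    set M : Fin n := ⟨m, hm⟩ with hM
    have hseqM : ∀ z, Λ.argSeq σ z m = Λ.arg z (σ M) := fun z => Λ.argSeq_of_lt σ z hm
    -- The condition forbids cutting the row right after a singular factor, which is only regular
    -- together with its successor. Steps may thus have length two, hence strong induction.
    have key : ∀ l ≤ m, (∀ i : Fin n, (i : ℕ) + 1 = l → Λ.content (σ i) ≠ Λ.content (σ M)) →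
        RegularOn Λ.genericSet (fun _ => y) fun z => triProd n (Λ.argSeq σ z) m *
          rowProd n (Λ.argSeq σ z) m (Λ.argSeq σ z m) l := by
      intro l
      induction l using Nat.strong_induction_on with
      | _ l ihl =>
      intro hlm hl
      rcases l with _ | l
      · simpa [rowProd] using ih
      set L : Fin n := ⟨l, by omega⟩ with hL
      have hseqL : ∀ z, Λ.argSeq σ z l = Λ.arg z (σ L) := fun z => Λ.argSeq_of_lt σ z _
      have hcL := hl L rfl
      by_cases hs : ∀ i : Fin n, (i : ℕ) + 1 = l → Λ.content (σ i) ≠ Λ.content (σ M)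
      · refine ((ihl l (by omega) (by omega) hs).mul
          (Λ.regularOn_baxter_arg hy (m - l) hcL)).congr fun z _ => ?_
        rw [rowProd, hseqL, ← hseqM, mul_assoc]
      · push Not at hs
        obtain ⟨i, hil, hci⟩ := hs
        have hiM : i < M := Fin.lt_def.2 (by simp [hM]; omega)
        obtain ⟨j, hji, hjM, hcj, r, hr, harg⟩ := Λ.exists_root_of_content_eq hσ hiM hci
        obtain rfl : j = L := Fin.ext (by simp [hL]; omega)
        -- Two consecutive factors cannot both be singular: the successor of a singular one has a
        -- different content.
        have hprev : ∀ i' : Fin n, (i' : ℕ) + 1 = i → Λ.content (σ i') ≠ Λ.content (σ M) := by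
          intro i' hi' hc'
          obtain ⟨j', hj', -, hcj', -⟩ := Λ.exists_root_of_content_eq hσ
            (show i' < M from Fin.lt_def.2 (by simp [hM]; omega)) hc'
          obtain rfl : j' = i := Fin.ext (by omega)
          exact hcj' hci
        have hreg := ihl i (by omega) (by omega) hprev
        have hbl := regularOn_projGen_mul_baxter_mul_baxter (W := Λ.genericSet)
          (p := fun _ => y) (k := m - l) (by omega) (by omega) hr (Λ.argPoly (σ i))
          (Λ.argPoly (σ M))
        simp only [eval_argPoly] at hbl
        have hbl := hbl
          (by
            rw [← harg _ (Λ.const_mem_hookSubspace y)]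
            exact Λ.arg_const_sub_ne_zero hy hcj.symm)
          (fun z hz => hz.2.1 _)
          (fun z hz => hz.2.2 _ _ fun h => hiM.ne (σ.injective h))
          (fun z hz => by
            rw [← harg _ hz.1]
            exact sub_ne_zero.2 (hz.2.2 _ _ fun h => hjM.ne' (σ.injective h)))
        refine (hreg.mul hbl).of_smul_eq (MvPolynomial.C (r + r⁻¹)) 1 ?_ fun z hz => ?_
        · have h1 := hr.sq_ne_neg_one
          have h2 := hr.ne_zero
          have : r + r⁻¹ = (r ^ 2 + 1) / r := by field_simp
          rw [MvPolynomial.eval_C, this]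
          exact div_ne_zero h1 h2
        · have hsucc : Λ.argSeq σ z (i + 1) = r ^ 2 * Λ.argSeq σ z i := by
            rw [hil, hseqL, argSeq_val, harg z hz.1]
          have hG := triProd_mul_projGen (m := m) hr (by omega) (by omega)
            (Λ.argSeq_ne_zero hz σ) (Λ.argSeq_ne hz σ) hsucc
          have e1 : m - 1 - i = m - l := by omega
          have e2 : m - i = m - l + 1 := by omega
          have hcomm : Commute (projGen n (m - l) r)
              (rowProd n (Λ.argSeq σ z) m (Λ.argSeq σ z m) i) :=
            (gen_commute_rowProd n _ _ (by omega)).add_left (Algebra.commutes _ _)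
          have hrow : rowProd n (Λ.argSeq σ z) m (Λ.argSeq σ z m) (l + 1) =
              rowProd n (Λ.argSeq σ z) m (Λ.argSeq σ z m) i *
                baxter n (m - l + 1) (Λ.arg z (σ i)) (Λ.arg z (σ M)) *
                  baxter n (m - l) (r ^ 2 * Λ.arg z (σ i)) (Λ.arg z (σ M)) := by
            rw [rowProd, hseqL, harg z hz.1, ← hil, rowProd, argSeq_val, hseqM, hil, e2]
          rw [e1] at hG
          rw [MvPolynomial.eval_C, map_one, one_smul, ← smul_mul_assoc, ← hG, hrow]
          simp only [mul_assoc]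
          rw [← mul_assoc (projGen n (m - l) r), hcomm.eq]
          simp only [mul_assoc]
    -- The last factor of the full row is not singular, since the successor of a singular one would
    -- still precede `M`.
    refine (key m le_rfl fun i hi hc => ?_).congr fun z _ => by rw [triProd]
    obtain ⟨j, hj, hjM, -⟩ := Λ.exists_root_of_content_eq hσ
      (show i < M from Fin.lt_def.2 (by simp [hM]; omega)) hc
    have : (j : ℕ) < m := hjM
    omega

/-! ### Reduction of an arbitrary tableau to the hook order -/

/-- The entries of a standard tableau increase along the componentwise order of boxes. -/
lemma le_of_box_le {a b : Fin n} (h : (Λ.box a).1 ≤ (Λ.box b).1) : a ≤ b := by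
  -- Go through the corner box in the row of `a` and the column of `b`.
  have hmem : ((Λ.box a).1.1, (Λ.box b).1.2) ∈ μ.cells :=
    μ.isLowerSet (show ((Λ.box a).1.1, (Λ.box b).1.2) ≤ (Λ.box b).1 from ⟨h.1, le_rfl⟩)
      (Λ.box b).2
  set c := Λ.box.symm ⟨_, hmem⟩ with hc
  have hbc : (Λ.box c).1 = ((Λ.box a).1.1, (Λ.box b).1.2) := by simp [hc]
  have hac : a ≤ c := by
    rcases h.2.lt_or_eq with h2 | h2
    · exact (Λ.row_lt a c (by rw [hbc]) (by rw [hbc]; exact h2)).le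
    · exact (Λ.box.injective (Subtype.ext (by rw [hbc, ← h2]))).le
  have hcb : c ≤ b := by
    rcases h.1.lt_or_eq with h2 | h2
    · exact (Λ.col_lt c b (by rw [hbc]) (by rw [hbc]; exact h2)).le
    · exact (Λ.box.injective (Subtype.ext (by rw [hbc, h2]))).le
  exact hac.trans hcb

/-- Of two incomparable boxes, one is strictly higher and strictly further right, so row and column
each contribute at least one. -/
lemma one_lt_abs_content_sub {a b : Fin n} (h1 : ¬ (Λ.box a).1 ≤ (Λ.box b).1)
    (h2 : ¬ (Λ.box b).1 ≤ (Λ.box a).1) : 1 < |Λ.content a - Λ.content b| := by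
  rw [Prod.le_def] at h1 h2
  simp only [content]
  rw [lt_abs]
  omega

/-- Regularity for every order in which the boxes may be added one by one. -/
lemma regularOn_of_linearExtension {y : Cq} (hy : y ≠ 0) (σ : Equiv.Perm (Fin n))
    (hσ : ∀ i j, (Λ.box (σ i)).1 ≤ (Λ.box (σ j)).1 → i ≤ j) :
    RegularOn Λ.genericSet (fun _ => y) fun z => triProd n (Λ.argSeq σ z) n := by
  -- Induction over the finitely many orderings, compared lexicographically by their sequences of
  -- keys: exchanging a descent makes the sequence smaller.
  let key : Equiv.Perm (Fin n) → Lex (Fin n → ℕ ×ₗ ℕ ×ₗ ℕ) :=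
    fun σ => toLex fun i => hookKey (Λ.box (σ i)).1
  let R : Equiv.Perm (Fin n) → Equiv.Perm (Fin n) → Prop := fun σ τ => key σ < key τ
  have : IsTrans _ R := ⟨fun _ _ _ => lt_trans⟩
  have : Std.Irrefl R := ⟨fun _ => lt_irrefl _⟩
  induction σ using (Finite.wellFounded_of_trans_of_irrefl R).induction with
  | _ σ ih =>
  by_cases hd : ∃ (i : ℕ) (hi : i + 1 < n),
      hookKey (Λ.box (σ ⟨i + 1, hi⟩)).1 < hookKey (Λ.box (σ ⟨i, by omega⟩)).1
  · obtain ⟨i, hi, hlt⟩ := hd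
    have hn1 : ¬ (Λ.box (σ ⟨i, by omega⟩)).1 ≤ (Λ.box (σ ⟨i + 1, hi⟩)).1 := fun h =>
      absurd hlt (not_lt.2 (hookKey_strictMono.monotone h))
    have hn2 : ¬ (Λ.box (σ ⟨i + 1, hi⟩)).1 ≤ (Λ.box (σ ⟨i, by omega⟩)).1 := fun h => by
      have := hσ _ _ h
      simp at this
    refine Λ.regularOn_of_swap hy σ hi (Λ.one_lt_abs_content_sub hn1 hn2) (ih _ ?_ ?_)
    · exact Pi.lex_desc (i := (⟨i, by omega⟩ : Fin n)) (j := ⟨i + 1, hi⟩)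
        (f := fun k => hookKey (Λ.box (σ k)).1) (by simp) hlt
    · intro j k hjk
      have := hσ _ _ hjk
      rw [Equiv.swap_apply_def, Equiv.swap_apply_def] at this
      rw [Equiv.Perm.mul_apply, Equiv.Perm.mul_apply, Equiv.swap_apply_def,
        Equiv.swap_apply_def] at hjk
      rw [Fin.le_def] at this ⊢
      simp only [Fin.ext_iff] at this hjk
      split_ifs at this hjk <;> (try simp only at this) <;>
        first | omega | exact absurd hjk hn1
  · push Not at hd
    refine Λ.regularOn_of_strictMono hy ?_ n le_rfl
    rcases n with _ | n
    · exact fun i => i.elim0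
    refine Fin.strictMono_iff_lt_succ.2 fun i => lt_of_le_of_ne (hd i (by omega)) fun h => ?_
    have := σ.injective (Λ.box.injective (Subtype.ext (hookKey_injective h)))
    simp [Fin.ext_iff] at this

/-- `h0` is needed because the domain does not force the argument of the last number to be nonzero.
-/
lemma mem_genericSet {z : Fin n → Cq} (hz : z ∈ Λ.hookSubspace) (hd : z ∈ Λ.domain)
    (h0 : ∀ a, z a ≠ 0) : z ∈ Λ.genericSet := by
  refine ⟨hz, fun a => mul_ne_zero (zpow_ne_zero _ q_ne_zero) (h0 a), fun a b hab => ?_⟩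
  rcases lt_or_gt_of_ne hab with h | h
  · exact (hd a b h).2
  · exact (hd b a h).2.symm

lemma restrictionRegularAt {y : Cq} (hy : y ≠ 0) :
    RestrictionRegularAt Λ.hookSubspace Λ.domain Λ.bigF fun _ => y := by
  have h := Λ.regularOn_of_linearExtension hy 1 fun i j h => Λ.le_of_box_le h
  have h := (h.congr fun z _ => Λ.bigF_eq z).extend (W' := {z | z ∈ Λ.hookSubspace ∧ z ∈ Λ.domain})
    -- Multiplying by all coordinates discards the points with a zero coordinate and is harmless at
    -- `(y, …, y)`.
    (∏ a : Fin n, MvPolynomial.X a) (by simp [hy]) fun z hz hne =>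
      Λ.mem_genericSet hz.1 hz.2 (by simpa [Finset.prod_eq_zero_iff] using hne)
  obtain ⟨g, P, hP, hg, hgP⟩ := h
  exact ⟨g, P, hP, hg, fun z hz hz' => hgP z ⟨hz, hz'⟩⟩

/-! ### Points of the hook subspace where all factors are defined -/

/-- The index of the principal hook containing a number. -/
def hookIndex (a : Fin n) : ℕ := min (Λ.box a).1.1 (Λ.box a).1.2

lemma hookIndex_eq_of_sameHook {a b : Fin n} (h : Λ.SameHook a b) :
    Λ.hookIndex a = Λ.hookIndex b := by
  obtain ⟨k, ⟨-, h1⟩, ⟨-, h2⟩⟩ := h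
  unfold hookIndex
  omega

lemma eq_of_content_of_hookIndex {a b : Fin n} (hc : Λ.content a = Λ.content b)
    (hk : Λ.hookIndex a = Λ.hookIndex b) : a = b := by
  unfold content at hc
  unfold hookIndex at hk
  exact Λ.box.injective (Subtype.ext (Prod.ext (by omega) (by omega)))

lemma exists_mem_domain : ∃ z ∈ Λ.hookSubspace, z ∈ Λ.domain := by
  -- `N` exceeds every difference of contents, so the exponent `content + N * hookIndex` determines
  -- both the content and the hook, hence the box.
  set N : ℤ := 1 + ∑ a, |Λ.content a| with hN
  have hq : ∀ a, Λ.arg (fun a => q ^ (2 * (N * Λ.hookIndex a))) a =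
      q ^ (2 * (Λ.content a + N * Λ.hookIndex a)) := fun a => by
    rw [arg, ← zpow_add₀ q_ne_zero, mul_add]
  refine ⟨fun a => q ^ (2 * (N * Λ.hookIndex a)), fun a b h => by
    simp only [Λ.hookIndex_eq_of_sameHook h], fun a b hab => ?_⟩
  rw [hq, hq]
  refine ⟨zpow_ne_zero _ q_ne_zero, fun h => hab.ne ?_⟩
  have h := q_zpow_injective h
  have hle : |Λ.content a| + |Λ.content b| ≤ ∑ a, |Λ.content a| := by
    rw [← Finset.sum_pair (f := fun a => |Λ.content a|) hab.ne]
    exact Finset.sum_le_univ_sum_of_nonneg fun _ => abs_nonneg _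
  have hd : N * ((Λ.hookIndex a : ℤ) - Λ.hookIndex b) = Λ.content b - Λ.content a := by
    linarith
  have hz : Λ.content b - Λ.content a = 0 := by
    refine Int.eq_zero_of_abs_lt_dvd ⟨_, hd.symm⟩ ?_
    exact (abs_sub _ _).trans_lt (by omega)
  rw [hz, mul_eq_zero] at hd
  have hNpos : 0 < N := by positivity
  exact Λ.eq_of_content_of_hookIndex (by omega) (by omega)

end StandardTableau

end HookFusion

/-- The rational function `F_Λ(z_1, …, z_n)` can be restricted to the principal-hook subspace, and
the restriction is regular at every point of the line `z_1 = ⋯ = z_n` other than the origin. -/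
theorem proposition2p3 (n : ℕ) (μ : YoungDiagram) (Λ : HookFusion.StandardTableau n μ) :
    (∃ z ∈ Λ.hookSubspace, z ∈ Λ.domain) ∧
      ∀ y : HookFusion.Cq, y ≠ 0 →
        HookFusion.RestrictionRegularAt Λ.hookSubspace Λ.domain Λ.bigF (fun _ => y) :=
  ⟨Λ.exists_mem_domain, fun _ hy => Λ.restrictionRegularAt hy⟩
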